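/- Let $\mathcal L$ be the set of formulas built from countably many propositional variables $p_0,p_1,p_2,\dots$ and the constant $\bot$ using implication $\rightarrow$ and a binary modality $\rhd$; put $\neg\phi:=\phi\rightarrow\bot$, $\top:=\neg\bot$, $\phi\vee\psi:=\neg\phi\rightarrow\psi$ and $\phi\wedge\psi:=\neg(\phi\rightarrow\neg\psi)$. The modal logic $\Re_d$ of deterministic partial recursive functions is the smallest set of formulas of $\mathcal L$ that contains all instances, with formulas of $\mathcal L$, of the axioms of classical propositional logic and of the axiom schemes - A1. $\phi\rhd\psi\rightarrow(\chi\rhd\psi\rightarrow(\phi\vee\chi)\rhd\psi)$, - A2. $\bot\rhd\phi$, - A3. $\phi\rhd\top$, - A4. $\phi\rhd\psi\rightarrow(\phi\rhd\chi\rightarrow\phi\rhd(\psi\wedge\chi))$, and is closed under Modus Ponens (from $\phi\rightarrow\psi$ and $\phi$ infer $\psi$) and the monotonicity rule M (from $\phi_1\rightarrow\phi_2$ and $\psi_1\rightarrow\psi_2$ infer $\phi_2\rhd\psi_1\rightarrow\phi_1\rhd\psi_2$). **Corollary.** The logic $\Re_d$ is decidable: there is an algorithm that, given a formula $\phi$ of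 $\mathcal L$, decides whether $\vdash_{\Re_d}\phi$. (That is, under a standard effective Gödel numbering of formulas, the set of theorems of $\Re_d$ is recursive.) -/

import Mathlib

namespace RecFunLogic

/-- Formulas of the modal language: propositional variables `p₀, p₁, p₂, …` and the constant `⊥`,
closed under implication and the binary modality `▷` (here `rhd`). -/
inductive Formula : Type
  | var (n : ℕ) : Formula
  | bot : Formula
  | imp (φ ψ : Formula) : Formula
  | rhd (φ ψ : Formula) : Formula

namespace Formula

/-- `¬φ` is `φ → ⊥`. -/
protected def neg (φ : Formula) : Formula := φ.imp bot

/-- `⊤` is `¬⊥`. -/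
protected def top : Formula := bot.neg

/-- `φ ∨ ψ` is `¬φ → ψ`. -/
protected def or (φ ψ : Formula) : Formula := φ.neg.imp ψ

/-- `φ ∧ ψ` is `¬(φ → ¬ψ)`. -/
protected def and (φ ψ : Formula) : Formula := (φ.imp ψ.neg).neg

/-- The Gödel number of a formula. -/
def toNat : Formula → ℕ
  | bot => 0
  | var n => 3 * n + 1
  | imp φ ψ => 3 * Nat.pair φ.toNat ψ.toNat + 2
  | rhd φ ψ => 3 * Nat.pair φ.toNat ψ.toNat + 3

/-- The formula with a given Gödel number. -/
def ofNat : ℕ → Formula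
  | 0 => bot
  | n + 1 =>
    have h1 : (n / 3).unpair.1 < n + 1 :=
      Nat.lt_succ_of_le ((Nat.unpair_left_le _).trans (Nat.div_le_self _ _))
    have h2 : (n / 3).unpair.2 < n + 1 :=
      Nat.lt_succ_of_le ((Nat.unpair_right_le _).trans (Nat.div_le_self _ _))
    match n % 3 with
    | 0 => var (n / 3)
    | 1 => imp (ofNat (n / 3).unpair.1) (ofNat (n / 3).unpair.2)
    | _ => rhd (ofNat (n / 3).unpair.1) (ofNat (n / 3).unpair.2)

theorem ofNat_toNat (φ : Formula) : ofNat φ.toNat = φ := by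
  induction φ with
  | bot => simp [toNat, ofNat]
  | var n => simp [toNat, ofNat]
  | imp φ ψ ih1 ih2 =>
    have hd : (3 * Nat.pair φ.toNat ψ.toNat + 1) / 3 = Nat.pair φ.toNat ψ.toNat := by omega
    have hm : (3 * Nat.pair φ.toNat ψ.toNat + 1) % 3 = 1 := by omega
    simp [toNat, ofNat, hd, hm, ih1, ih2]
  | rhd φ ψ ih1 ih2 =>
    have hd : (3 * Nat.pair φ.toNat ψ.toNat + 2) / 3 = Nat.pair φ.toNat ψ.toNat := by omega
    have hm : (3 * Nat.pair φ.toNat ψ.toNat + 2) % 3 = 2 := by omega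
    simp [toNat, ofNat, hd, hm, ih1, ih2]

theorem toNat_ofNat (n : ℕ) : (ofNat n).toNat = n := by
  induction n using Nat.strong_induction_on with
  | _ n ih =>
    cases n with
    | zero => simp [toNat, ofNat]
    | succ n =>
      have h1 := ih (n / 3).unpair.1
        (Nat.lt_succ_of_le ((Nat.unpair_left_le _).trans (Nat.div_le_self _ _)))
      have h2 := ih (n / 3).unpair.2
        (Nat.lt_succ_of_le ((Nat.unpair_right_le _).trans (Nat.div_le_self _ _)))
      have hlt : n % 3 < 3 := Nat.mod_lt _ (by norm_num)
      rcases (by omega : n % 3 = 0 ∨ n % 3 = 1 ∨ n % 3 = 2) with h | h | h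
      · simp only [ofNat, h, toNat]; omega
      · simp only [ofNat, h, toNat, h1, h2, Nat.pair_unpair]; omega
      · simp only [ofNat, h, toNat, h1, h2, Nat.pair_unpair]; omega

/-- The explicit Gödel numbering of formulas, with respect to which the computability of
predicates on formulas is understood. -/
instance instDenumerable : Denumerable Formula :=
  Denumerable.mk' ⟨toNat, ofNat, ofNat_toNat, toNat_ofNat⟩

end Formula

/-- `Provable φ`: the formula `φ` is a theorem of the modal logic `ℜ_d` of deterministic partial
recursive functions. The Hilbert calculus consists of an axiomatization of classical propositional
logic (`k`, `s`, `dne`), the axioms `a1`-`a4`, Modus Ponens and the monotonicity rule `mono`. -/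
inductive Provable : Formula → Prop
  | k (φ ψ : Formula) : Provable (φ.imp (ψ.imp φ))
  | s (φ ψ χ : Formula) :
      Provable ((φ.imp (ψ.imp χ)).imp ((φ.imp ψ).imp (φ.imp χ)))
  | dne (φ : Formula) : Provable (φ.neg.neg.imp φ)
  | a1 (φ ψ χ : Formula) :
      Provable ((φ.rhd ψ).imp ((χ.rhd ψ).imp ((φ.or χ).rhd ψ)))
  | a2 (φ : Formula) : Provable (Formula.bot.rhd φ)
  | a3 (φ : Formula) : Provable (φ.rhd Formula.top)
  | a4 (φ ψ χ : Formula) :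
      Provable ((φ.rhd ψ).imp ((φ.rhd χ).imp (φ.rhd (ψ.and χ))))
  | mp {φ ψ : Formula} : Provable (φ.imp ψ) → Provable φ → Provable ψ
  | mono {φ₁ φ₂ ψ₁ ψ₂ : Formula} : Provable (φ₁.imp φ₂) → Provable (ψ₁.imp ψ₂) →
      Provable ((φ₂.rhd ψ₁).imp (φ₁.rhd ψ₂))

end RecFunLogic

namespace RecFunLogic

open Formula

/-! ### Derivations from hypotheses and maximal consistent sets -/

/-! The logic has the finite model property with a computable bound on the size of countermodels.
The models carry a ternary relation, `φ ▷ ψ` being true at `w` when every accessible pair `(x, y)`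
with `φ` at `x` has `ψ` at `y`. All such models are sound (`Provable.satisfies`). Conversely, an
unprovable formula is omitted by some maximal consistent set, and `exists_pair_of_rhd_notMem`
supplies the pairs of a canonical model. Restricting its worlds to formulas with Gödel number at
most that of the given formula, a finite set containing all its subformulas, filters it to a finite
model. Such models are coded by bounded numbers, so `Refutable` is primitive recursive, and
`provable_iff_not_refutable` transfers this to provability. -/

/-- Derivability from a set of hypotheses by Modus Ponens alone. -/
inductive Derives (Γ : Set Formula) : Formula → Prop
  | ax {φ : Formula} : Provable φ → Derives Γ φ
  | hyp {φ : Formula} : φ ∈ Γ → Derives Γ φ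
  | mp {φ ψ : Formula} : Derives Γ (φ.imp ψ) → Derives Γ φ → Derives Γ ψ

theorem Provable.imp_self (φ : Formula) : Provable (φ.imp φ) :=
  .mp (.mp (.s φ (φ.imp φ) φ) (.k φ (φ.imp φ))) (.k φ φ)

namespace Derives

theorem provable {φ : Formula} (h : Derives ∅ φ) : Provable φ := by
  induction h with
  | ax h => exact h
  | hyp h => exact h.elim
  | mp _ _ ih₁ ih₂ => exact .mp ih₁ ih₂

/-- The rule M acts only inside `Provable`, never on hypotheses, so it adds no case here. -/
theorem deduction {Γ : Set Formula} {φ ψ : Formula} (h : Derives (insert φ Γ) ψ) :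
    Derives Γ (φ.imp ψ) := by
  induction h with
  | ax h => exact .mp (.ax (.k _ _)) (.ax h)
  | hyp h =>
    rcases h with rfl | h
    · exact .ax (.imp_self _)
    · exact .mp (.ax (.k _ _)) (.hyp h)
  | mp _ _ ih₁ ih₂ => exact .mp (.mp (.ax (.s _ _ _)) ih₁) ih₂

theorem of_bot {Γ : Set Formula} (h : Derives Γ bot) (φ : Formula) : Derives Γ φ :=
  .mp (.ax (.dne φ)) (.mp (.ax (.k bot φ.neg)) h)

/-- Compactness in the form needed for Zorn's lemma: it keeps unions of chains consistent. -/
theorem of_sUnion {c : Set (Set Formula)} (hc : IsChain (· ⊆ ·) c) (hne : c.Nonempty)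
    {φ : Formula} (h : Derives (⋃₀ c) φ) : ∃ Γ ∈ c, Derives Γ φ := by
  have mono {Γ Δ : Set Formula} (hs : Γ ⊆ Δ) {φ : Formula} (h : Derives Γ φ) : Derives Δ φ := by
    induction h with
    | ax h => exact .ax h
    | hyp h => exact .hyp (hs h)
    | mp _ _ ih₁ ih₂ => exact .mp ih₁ ih₂
  induction h with
  | ax h => exact ⟨_, hne.some_mem, .ax h⟩
  | hyp h =>
    obtain ⟨Γ, hΓ, h⟩ := h
    exact ⟨Γ, hΓ, .hyp h⟩
  | mp _ _ ih₁ ih₂ =>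
    obtain ⟨Γ, hΓ, h₁⟩ := ih₁
    obtain ⟨Δ, hΔ, h₂⟩ := ih₂
    rcases hc.total hΓ hΔ with hs | hs
    · exact ⟨Δ, hΔ, .mp (mono hs h₁) h₂⟩
    · exact ⟨Γ, hΓ, .mp h₁ (mono hs h₂)⟩

end Derives

/-- Maximal consistent sets of formulas, described by their closure properties. -/
structure IsMaximalConsistent (x : Set Formula) : Prop where
  provable_mem {φ : Formula} : Provable φ → φ ∈ x
  bot_notMem : bot ∉ x
  imp_mem {φ ψ : Formula} : φ.imp ψ ∈ x ↔ (φ ∈ x → ψ ∈ x)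

/-- Lindenbaum's lemma: Zorn's lemma applied above `Γ` together with the negation of `ψ`. -/
theorem Derives.exists_isMaximalConsistent {Γ : Set Formula} {ψ : Formula}
    (h : ¬ Derives Γ ψ) : ∃ x, IsMaximalConsistent x ∧ Γ ⊆ x ∧ ψ ∉ x := by
  have h₀ : ¬ Derives (insert ψ.neg Γ) bot := fun hb ↦ h (.mp (.ax (.dne ψ)) hb.deduction)
  obtain ⟨x, hΓx, hx⟩ := zorn_subset_nonempty {Δ | ¬ Derives Δ bot}
    (fun c hc hch hne ↦ ⟨⋃₀ c, fun hb ↦ by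
      obtain ⟨Δ, hΔ, hb⟩ := Derives.of_sUnion hch hne hb
      exact hc hΔ hb, fun _ ↦ Set.subset_sUnion_of_mem⟩) _ h₀
  have hcons : ¬ Derives x bot := hx.prop
  have hneg {φ : Formula} (hφ : φ ∉ x) : Derives x φ.neg := by
    by_contra hc
    exact hφ (hx.le_of_ge (y := insert φ x) (fun hb ↦ hc hb.deduction) (Set.subset_insert _ _)
      (Set.mem_insert _ _))
  have hmem {φ : Formula} (hφ : Derives x φ) : φ ∈ x := by
    by_contra hc
    exact hcons (.mp (hneg hc) hφ)
  refine ⟨x, ⟨fun h ↦ hmem (.ax h), fun hb ↦ hcons (.hyp hb), fun {φ χ} ↦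
    ⟨fun h₁ h₂ ↦ hmem (.mp (.hyp h₁) (.hyp h₂)), fun hi ↦ ?_⟩⟩,
    (Set.subset_insert _ _).trans hΓx,
    fun hψ ↦ hcons (.mp (.hyp (hΓx (Set.mem_insert _ _))) (.hyp hψ))⟩
  by_cases hφ : φ ∈ x
  · exact hmem (.mp (.ax (.k _ _)) (.hyp (hi hφ)))
  · refine hmem (Derives.deduction (Derives.of_bot ?_ χ))
    refine .mp ?_ (.hyp (Set.mem_insert _ _))
    exact .hyp (Set.mem_insert_of_mem _ (hmem (hneg hφ)))

theorem exists_isMaximalConsistent_of_not_provable {φ : Formula} (h : ¬ Provable φ) :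
    ∃ x, IsMaximalConsistent x ∧ φ ∉ x := by
  obtain ⟨x, hx, -, hφ⟩ := Derives.exists_isMaximalConsistent (Γ := ∅) fun hd ↦ h hd.provable
  exact ⟨x, hx, hφ⟩

/-- Replaces Hilbert-style derivations of tautologies by propositional reasoning about membership.
-/
theorem Provable.of_forall_mem {φ : Formula} (h : ∀ x, IsMaximalConsistent x → φ ∈ x) :
    Provable φ := by
  by_contra hc
  obtain ⟨x, hx, hφ⟩ := exists_isMaximalConsistent_of_not_provable hc
  exact hφ (h x hx)

namespace IsMaximalConsistent

theorem neg_mem {x : Set Formula} (hx : IsMaximalConsistent x) {φ : Formula} :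
    φ.neg ∈ x ↔ φ ∉ x := by
  simp [Formula.neg, hx.imp_mem, hx.bot_notMem]

theorem or_mem {x : Set Formula} (hx : IsMaximalConsistent x) {φ ψ : Formula} :
    φ.or ψ ∈ x ↔ φ ∈ x ∨ ψ ∈ x := by
  simp only [Formula.or, hx.imp_mem, hx.neg_mem]
  tauto

theorem and_mem {x : Set Formula} (hx : IsMaximalConsistent x) {φ ψ : Formula} :
    φ.and ψ ∈ x ↔ φ ∈ x ∧ ψ ∈ x := by
  simp only [Formula.and, hx.imp_mem, hx.neg_mem]
  tauto

theorem mem_of_provable_imp {x : Set Formula} (hx : IsMaximalConsistent x) {φ ψ : Formula}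
    (h : Provable (φ.imp ψ)) (hφ : φ ∈ x) : ψ ∈ x :=
  hx.imp_mem.1 (hx.provable_mem h) hφ

theorem rhd_mono {x : Set Formula} (hx : IsMaximalConsistent x) {φ₁ φ₂ ψ₁ ψ₂ : Formula}
    (hφ : Provable (φ₁.imp φ₂)) (hψ : Provable (ψ₁.imp ψ₂)) (h : φ₂.rhd ψ₁ ∈ x) :
    φ₁.rhd ψ₂ ∈ x :=
  hx.mem_of_provable_imp (.mono hφ hψ) h

theorem or_rhd_mem {x : Set Formula} (hx : IsMaximalConsistent x) {φ ψ χ : Formula}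
    (h₁ : φ.rhd ψ ∈ x) (h₂ : χ.rhd ψ ∈ x) : (φ.or χ).rhd ψ ∈ x :=
  hx.imp_mem.1 (hx.mem_of_provable_imp (.a1 φ ψ χ) h₁) h₂

theorem rhd_and_mem {x : Set Formula} (hx : IsMaximalConsistent x) {φ ψ χ : Formula}
    (h₁ : φ.rhd ψ ∈ x) (h₂ : φ.rhd χ ∈ x) : φ.rhd (ψ.and χ) ∈ x :=
  hx.imp_mem.1 (hx.mem_of_provable_imp (.a4 φ ψ χ) h₁) h₂

/-- A maximal consistent set omitting `α ▷ β` has an accessible pair of maximal consistent sets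
that witnesses the failure of `α ▷ β`. -/
theorem exists_pair_of_rhd_notMem {w : Set Formula} (hw : IsMaximalConsistent w)
    {α β : Formula} (h : α.rhd β ∉ w) :
    ∃ x y, IsMaximalConsistent x ∧ IsMaximalConsistent y ∧
      (∀ φ ψ, φ.rhd ψ ∈ w → φ ∈ x → ψ ∈ y) ∧ α ∈ x ∧ β ∉ y := by
  -- By A1 and A2 the `δ` with `δ ▷ β ∈ w` are closed under disjunction and include `⊥`. Were `α`
  -- inconsistent with all their negations, it would imply one such `δ`, and M would give `α ▷ β ∈
  -- w`.
  have hleft {φ : Formula} (hd : Derives (insert α {φ | ∃ δ : Formula, δ.rhd β ∈ w ∧ φ = δ.neg}) φ) :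
      ∃ δ : Formula, δ.rhd β ∈ w ∧ Provable (α.imp (δ.or φ)) := by
    induction hd with
    | @ax φ hp =>
      exact ⟨bot, hw.provable_mem (.a2 β), .of_forall_mem fun x hx ↦ by
        simp [hx.imp_mem, hx.or_mem, hx.provable_mem hp]⟩
    | @hyp φ hm =>
      rcases hm with rfl | ⟨δ, hδ, rfl⟩
      · exact ⟨bot, hw.provable_mem (.a2 β), .of_forall_mem fun x hx ↦ by
          simp [hx.imp_mem, hx.or_mem]; tauto⟩
      · exact ⟨δ, hδ, .of_forall_mem fun x hx ↦ by
          simp only [hx.imp_mem, hx.or_mem, hx.neg_mem]; tauto⟩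
    | mp _ _ ih₁ ih₂ =>
      obtain ⟨δ, hδ, h₁⟩ := ih₁
      obtain ⟨ε, hε, h₂⟩ := ih₂
      refine ⟨δ.or ε, hw.or_rhd_mem hδ hε, .of_forall_mem fun x hx ↦ ?_⟩
      have h₁ := hx.provable_mem h₁
      have h₂ := hx.provable_mem h₂
      simp only [hx.imp_mem, hx.or_mem] at h₁ h₂ ⊢
      tauto
  obtain ⟨x, hx, hsub, -⟩ := Derives.exists_isMaximalConsistent
    (Γ := insert α {φ | ∃ δ : Formula, δ.rhd β ∈ w ∧ φ = δ.neg}) (ψ := bot) fun hd ↦ by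
      obtain ⟨δ, hδ, hp⟩ := hleft hd
      refine h (hw.rhd_mono (.of_forall_mem fun x hx ↦ ?_) (.imp_self β) hδ)
      simpa [hx.imp_mem, hx.or_mem, hx.bot_notMem] using hx.provable_mem hp
  -- By A3, A4 and M the formulas forced on `y` are already deductively closed. So `β` is derivable
  -- only if some `γ ∈ x` has `γ ▷ β ∈ w`, but then `x` contains `¬γ`.
  have hright {φ : Formula} (hd : Derives {ψ | ∃ γ ∈ x, γ.rhd ψ ∈ w} φ) :
      ∃ γ ∈ x, γ.rhd φ ∈ w := by
    induction hd with
    | @ax φ hp =>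
      exact ⟨Formula.top, hx.provable_mem (.imp_self bot),
        hw.rhd_mono (.imp_self _) (.mp (.k _ _) hp) (hw.provable_mem (.a3 Formula.top))⟩
    | hyp hm => exact hm
    | @mp φ ψ _ _ ih₁ ih₂ =>
      obtain ⟨γ, hγ, h₁⟩ := ih₁
      obtain ⟨δ, hδ, h₂⟩ := ih₂
      refine ⟨γ.and δ, hx.and_mem.2 ⟨hγ, hδ⟩, ?_⟩
      have h₁ : (γ.and δ).rhd (φ.imp ψ) ∈ w := hw.rhd_mono (.of_forall_mem fun z hz ↦ by
        simp only [hz.imp_mem, hz.and_mem]; tauto) (.imp_self _) h₁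
      have h₂ : (γ.and δ).rhd φ ∈ w := hw.rhd_mono (.of_forall_mem fun z hz ↦ by
        simp only [hz.imp_mem, hz.and_mem]; tauto) (.imp_self _) h₂
      refine hw.rhd_mono (.imp_self _) (.of_forall_mem fun z hz ↦ ?_) (hw.rhd_and_mem h₁ h₂)
      simp only [hz.imp_mem, hz.and_mem]
      tauto
  obtain ⟨y, hy, hsub', hβ⟩ := Derives.exists_isMaximalConsistent
    (Γ := {ψ | ∃ γ ∈ x, γ.rhd ψ ∈ w}) (ψ := β) fun hd ↦ by
      obtain ⟨γ, hγ, hγβ⟩ := hright hd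
      exact hx.neg_mem.1 (hsub (Set.mem_insert_of_mem _ ⟨γ, hγβ, rfl⟩)) hγ
  exact ⟨x, y, hx, hy, fun φ ψ hφψ hφ ↦ hsub' ⟨φ, hφ, hφψ⟩, hsub (Set.mem_insert _ _), hβ⟩

end IsMaximalConsistent

/-! ### Relational semantics -/

/-- Truth in a model with a ternary accessibility relation: `α ▷ β` holds at `w` if every pair
accessible from `w` whose first component satisfies `α` has a second component satisfying `β`. -/
def Satisfies {W : Type*} (R : W → W → W → Prop) (V : W → ℕ → Prop) : Formula → W → Prop
  | var n, w => V w n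
  | bot, _ => False
  | imp φ ψ, w => Satisfies R V φ w → Satisfies R V ψ w
  | rhd φ ψ, w => ∀ x y, R w x y → Satisfies R V φ x → Satisfies R V ψ y

/-- No condition on `R` is needed, so filtration has no frame property to preserve. -/
theorem Provable.satisfies {W : Type*} (R : W → W → W → Prop) (V : W → ℕ → Prop) {φ : Formula}
    (h : Provable φ) (w : W) : Satisfies R V φ w := by
  induction h generalizing w with
  | k φ ψ => exact fun h _ ↦ h
  | s φ ψ χ => exact fun h₁ h₂ h₃ ↦ h₁ h₃ (h₂ h₃)
  | dne φ => exact fun h ↦ by_contra h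
  | a1 φ ψ χ =>
    intro h₁ h₂ x y hR hor
    by_cases hφ : Satisfies R V φ x
    · exact h₁ x y hR hφ
    · exact h₂ x y hR (hor hφ)
  | a2 φ => exact fun _ _ _ h ↦ h.elim
  | a3 φ => exact fun _ _ _ _ h ↦ h
  | a4 φ ψ χ => exact fun h₁ h₂ x y hR hφ h ↦ h (h₁ x y hR hφ) (h₂ x y hR hφ)
  | mp _ _ ih₁ ih₂ => exact ih₁ w (ih₂ w)
  | mono _ _ ih₁ ih₂ => exact fun h x y hR hφ ↦ ih₂ y (h x y hR (ih₁ x hφ))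

/-! ### Finite countermodels coded by natural numbers

A number `v` codes the set of all formulas whose Gödel number is the position of a binary digit `1`
of `v`, and a number `T` codes a set of such sets. -/

/-- The Gödel number of an implication in terms of those of its components. -/
def impCode (a b : ℕ) : ℕ := 3 * Nat.pair a b + 2

/-- The Gödel number of a `▷`-formula in terms of those of its components. -/
def rhdCode (a b : ℕ) : ℕ := 3 * Nat.pair a b + 3

theorem lt_impCode (a b : ℕ) : a < impCode a b ∧ b < impCode a b := by
  have := Nat.left_le_pair a b
  have := Nat.right_le_pair a b
  unfold impCode
  omega

theorem lt_rhdCode (a b : ℕ) : a < rhdCode a b ∧ b < rhdCode a b := by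
  have := Nat.left_le_pair a b
  have := Nat.right_le_pair a b
  unfold rhdCode
  omega

/-- The ternary accessibility relation on the set of worlds coded by `T`, with respect to formulas
with Gödel numbers below `n`. -/
def Access (n T v x y : ℕ) : Prop :=
  T.testBit x ∧ T.testBit y ∧
    ∀ a < n, ∀ b < n, v.testBit (rhdCode a b) → x.testBit a → y.testBit b

/-- The world `v` obeys the truth conditions of all formulas with Gödel numbers below `n`. -/
def Coherent (n T v : ℕ) : Prop :=
  ¬ v.testBit 0 ∧ ∀ a < n, ∀ b < n,
    (impCode a b < n → (v.testBit (impCode a b) ↔ (v.testBit a → v.testBit b))) ∧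
    (rhdCode a b < n →
      (∀ x < 2 ^ n, ∀ y < 2 ^ n, Access n T v x y → x.testBit a → y.testBit b) →
        v.testBit (rhdCode a b))

/-- There is a coded finite model that refutes the formula with Gödel number `N`. -/
def Refutable (N : ℕ) : Prop :=
  ∃ T < 2 ^ 2 ^ (N + 1),
    (∀ v < 2 ^ (N + 1), T.testBit v → Coherent (N + 1) T v) ∧
      ∃ v < 2 ^ (N + 1), T.testBit v ∧ ¬ v.testBit N

/-- Truth lemma. `Coherent` demands only one direction for `▷`; the other is built into `Access`. -/
theorem satisfies_iff_testBit {n T : ℕ} (hT : T < 2 ^ 2 ^ n)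
    (hc : ∀ v < 2 ^ n, T.testBit v → Coherent n T v) (φ : Formula) :
    φ.toNat < n → ∀ v, T.testBit v →
      (Satisfies (Access n T) (fun v i ↦ v.testBit (var i).toNat) φ v ↔ v.testBit φ.toNat) := by
  have hlt {v : ℕ} (hv : T.testBit v) : v < 2 ^ n := by
    by_contra hle
    rw [Nat.testBit_eq_false_of_lt
      (hT.trans_le (Nat.pow_le_pow_right two_pos (not_lt.1 hle)))] at hv
    exact Bool.false_ne_true hv
  induction φ with
  | var i => exact fun _ _ _ ↦ Iff.rfl
  | bot =>
    intro _ v hv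
    exact ⟨False.elim, (hc v (hlt hv) hv).1⟩
  | imp φ ψ ih₁ ih₂ =>
    intro hn v hv
    obtain ⟨h₁, h₂⟩ := lt_impCode φ.toNat ψ.toNat
    have h₁ := h₁.trans hn
    have h₂ := h₂.trans hn
    rw [Satisfies, ih₁ h₁ v hv, ih₂ h₂ v hv]
    exact (((hc v (hlt hv) hv).2 _ h₁ _ h₂).1 hn).symm
  | rhd φ ψ ih₁ ih₂ =>
    intro hn v hv
    obtain ⟨h₁, h₂⟩ := lt_rhdCode φ.toNat ψ.toNat
    have h₁ := h₁.trans hn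
    have h₂ := h₂.trans hn
    constructor
    · intro h
      refine ((hc v (hlt hv) hv).2 _ h₁ _ h₂).2 hn fun x _ y _ hR hx ↦ ?_
      exact (ih₂ h₂ y hR.2.1).1 (h x y hR ((ih₁ h₁ x hR.1).2 hx))
    · intro h x y hR hx
      exact (ih₂ h₂ y hR.2.1).2 (hR.2.2 _ h₁ _ h₂ h ((ih₁ h₁ x hR.1).1 hx))

theorem Refutable.not_provable {φ : Formula} (h : Refutable φ.toNat) : ¬ Provable φ := by
  obtain ⟨T, hT, hc, v, -, hv, hφ⟩ := h
  exact fun hp ↦ hφ ((satisfies_iff_testBit hT hc φ (Nat.lt_succ_self _) v hv).1 (hp.satisfies _ _ v))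

/-! ### Completeness: filtration of the canonical model -/

open Classical in
/-- The number coding the set of those elements of `x` with Gödel number below `n`. -/
noncomputable def typeCode (n : ℕ) (x : Set Formula) : ℕ :=
  Nat.ofBits fun i : Fin n ↦ decide (Formula.ofNat i ∈ x)

theorem typeCode_lt (n : ℕ) (x : Set Formula) : typeCode n x < 2 ^ n :=
  Nat.ofBits_lt_two_pow _

theorem testBit_typeCode {n i : ℕ} {x : Set Formula} :
    (typeCode n x).testBit i ↔ i < n ∧ Formula.ofNat i ∈ x := by
  by_cases hi : i < n <;> simp [typeCode, hi, Nat.testBit_ofBits_ge, not_lt.1]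

theorem ofNat_impCode (a b : ℕ) :
    Formula.ofNat (impCode a b) = (Formula.ofNat a).imp (Formula.ofNat b) := by
  conv_lhs => rw [← toNat_ofNat a, ← toNat_ofNat b]
  exact ofNat_toNat ((Formula.ofNat a).imp (Formula.ofNat b))

theorem ofNat_rhdCode (a b : ℕ) :
    Formula.ofNat (rhdCode a b) = (Formula.ofNat a).rhd (Formula.ofNat b) := by
  conv_lhs => rw [← toNat_ofNat a, ← toNat_ofNat b]
  exact ofNat_toNat ((Formula.ofNat a).rhd (Formula.ofNat b))

open Classical in
theorem exists_testBit_iff_typeCode (n : ℕ) :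
    ∃ T < 2 ^ 2 ^ n, ∀ v, T.testBit v ↔ ∃ x, IsMaximalConsistent x ∧ typeCode n x = v := by
  refine ⟨Nat.ofBits fun v : Fin (2 ^ n) ↦
    decide (∃ x, IsMaximalConsistent x ∧ typeCode n x = v), Nat.ofBits_lt_two_pow _, fun v ↦ ?_⟩
  by_cases hv : v < 2 ^ n
  · simp [Nat.testBit_ofBits_lt, hv]
  · rw [Nat.testBit_ofBits_ge _ _ (not_lt.1 hv)]
    simp only [Bool.false_eq_true, false_iff, not_exists, not_and]
    rintro x - rfl
    exact hv (typeCode_lt n x)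

theorem IsMaximalConsistent.coherent_typeCode {n T : ℕ}
    (hT : ∀ v, T.testBit v ↔ ∃ x, IsMaximalConsistent x ∧ typeCode n x = v)
    {w : Set Formula} (hw : IsMaximalConsistent w) : Coherent n T (typeCode n w) := by
  refine ⟨fun h ↦ hw.bot_notMem ?_, fun a ha b hb ↦ ⟨fun hab ↦ ?_, fun hab hall ↦ ?_⟩⟩
  · simpa [Formula.ofNat] using (testBit_typeCode.1 h).2
  · simp [testBit_typeCode, ha, hb, hab, ofNat_impCode, hw.imp_mem]
  · rw [testBit_typeCode, ofNat_rhdCode]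
    refine ⟨hab, by_contra fun hc ↦ ?_⟩
    obtain ⟨x, y, hx, hy, hR, hα, hβ⟩ := hw.exists_pair_of_rhd_notMem hc
    -- The types of `x` and `y` stay accessible, because `Access` tests only those `▷`-formulas of
    -- `w` that survive truncation.
    refine hβ (testBit_typeCode.1 (hall _ (typeCode_lt n x) _ (typeCode_lt n y)
      ⟨(hT _).2 ⟨x, hx, rfl⟩, (hT _).2 ⟨y, hy, rfl⟩, fun c _ d hd hcd hcx ↦ ?_⟩
      (testBit_typeCode.2 ⟨ha, hα⟩))).2
    rw [testBit_typeCode, ofNat_rhdCode] at hcd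
    exact testBit_typeCode.2 ⟨hd, hR _ _ hcd.2 (testBit_typeCode.1 hcx).2⟩

theorem refutable_of_not_provable {φ : Formula} (h : ¬ Provable φ) : Refutable φ.toNat := by
  obtain ⟨x, hx, hφ⟩ := exists_isMaximalConsistent_of_not_provable h
  obtain ⟨T, hlt, hT⟩ := exists_testBit_iff_typeCode (φ.toNat + 1)
  refine ⟨T, hlt, fun v _ hv ↦ ?_, typeCode _ x, typeCode_lt _ x, (hT _).2 ⟨x, hx, rfl⟩, ?_⟩
  · obtain ⟨w, hw, rfl⟩ := (hT v).1 hv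
    exact hw.coherent_typeCode hT
  · rw [testBit_typeCode, ofNat_toNat]
    exact fun hc ↦ hφ hc.2

theorem provable_iff_not_refutable (φ : Formula) : Provable φ ↔ ¬ Refutable φ.toNat :=
  ⟨fun h hr ↦ hr.not_provable h, fun h ↦ by_contra fun hp ↦ h (refutable_of_not_provable hp)⟩

/-! ### Primitive recursiveness -/

section Primrec

variable {α : Type*} [Primcodable α]

theorem primrecPred_imp {p q : α → Prop} (hp : PrimrecPred p) (hq : PrimrecPred q) :
    PrimrecPred fun a ↦ p a → q a :=
  (hp.not.or hq).of_eq fun _ ↦ imp_iff_not_or.symm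

theorem primrecPred_iff {p q : α → Prop} (hp : PrimrecPred p) (hq : PrimrecPred q) :
    PrimrecPred fun a ↦ (p a ↔ q a) :=
  ((primrecPred_imp hp hq).and (primrecPred_imp hq hp)).of_eq fun _ ↦ iff_iff_implies_and_implies.symm

theorem primrecPred_forall_lt {p : α → ℕ → Prop} {f : α → ℕ} (hf : Primrec f)
    (hp : PrimrecPred fun q : α × ℕ ↦ p q.1 q.2) : PrimrecPred fun a ↦ ∀ x < f a, p a x :=
  ((PrimrecRel.forall_mem_list (R := fun (x : ℕ) (a : α) ↦ p a x)
    (hp.comp (Primrec.pair .snd .fst))).comp (Primrec.list_range.comp hf) .id).of_eq fun _ ↦ by simp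

theorem primrecPred_exists_lt {p : α → ℕ → Prop} {f : α → ℕ} (hf : Primrec f)
    (hp : PrimrecPred fun q : α × ℕ ↦ p q.1 q.2) : PrimrecPred fun a ↦ ∃ x < f a, p a x :=
  ((PrimrecRel.exists_mem_list (R := fun (x : ℕ) (a : α) ↦ p a x)
    (hp.comp (Primrec.pair .snd .fst))).comp (Primrec.list_range.comp hf) .id).of_eq fun _ ↦ by simp

theorem primrec_two_pow {f : α → ℕ} (hf : Primrec f) : Primrec fun a ↦ 2 ^ f a :=
  (Primrec₂.unpaired'.1 Nat.Primrec.pow).comp (.const 2) hf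

theorem primrecPred_testBit {f g : α → ℕ} (hf : Primrec f) (hg : Primrec g) :
    PrimrecPred fun a ↦ (f a).testBit (g a) = true :=
  (Primrec.eq.comp (Primrec.nat_mod.comp (Primrec.nat_div.comp hf (primrec_two_pow hg)) (.const 2))
    (.const 1)).of_eq fun _ ↦ by simp [Nat.testBit_eq_decide_div_mod_eq]

theorem primrec_impCode {f g : α → ℕ} (hf : Primrec f) (hg : Primrec g) :
    Primrec fun a ↦ impCode (f a) (g a) :=
  Primrec.nat_add.comp (Primrec.nat_mul.comp (.const 3) (Primrec₂.natPair.comp hf hg)) (.const 2)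

theorem primrec_rhdCode {f g : α → ℕ} (hf : Primrec f) (hg : Primrec g) :
    Primrec fun a ↦ rhdCode (f a) (g a) :=
  Primrec.nat_add.comp (Primrec.nat_mul.comp (.const 3) (Primrec₂.natPair.comp hf hg)) (.const 3)

theorem primrecPred_access {n T v x y : α → ℕ} (hn : Primrec n) (hT : Primrec T) (hv : Primrec v)
    (hx : Primrec x) (hy : Primrec y) :
    PrimrecPred fun a ↦ Access (n a) (T a) (v a) (x a) (y a) := by
  have h : Primrec fun q : (α × ℕ) × ℕ ↦ q.1.1 := Primrec.fst.comp .fst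
  have hb : Primrec fun q : (α × ℕ) × ℕ ↦ q.1.2 := Primrec.snd.comp .fst
  refine (primrecPred_testBit hT hx).and ((primrecPred_testBit hT hy).and ?_)
  refine primrecPred_forall_lt hn (primrecPred_forall_lt (hn.comp .fst) ?_)
  exact primrecPred_imp (primrecPred_testBit (hv.comp h) (primrec_rhdCode hb .snd))
    (primrecPred_imp (primrecPred_testBit (hx.comp h) hb) (primrecPred_testBit (hy.comp h) .snd))

theorem primrecPred_coherent {n T v : α → ℕ} (hn : Primrec n) (hT : Primrec T) (hv : Primrec v) :
    PrimrecPred fun a ↦ Coherent (n a) (T a) (v a) := by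
  -- Each bounded quantifier appends a component: `q.1.1` is the parameter, `q.1.2` the outer
  -- variable, `q.2` the inner one.
  have h : Primrec fun q : (α × ℕ) × ℕ ↦ q.1.1 := Primrec.fst.comp .fst
  have hb : Primrec fun q : (α × ℕ) × ℕ ↦ q.1.2 := Primrec.snd.comp .fst
  have h' : Primrec fun q : (((α × ℕ) × ℕ) × ℕ) × ℕ ↦ q.1.1 := Primrec.fst.comp .fst
  have hx : Primrec fun q : (((α × ℕ) × ℕ) × ℕ) × ℕ ↦ q.1.2 := Primrec.snd.comp .fst
  refine (primrecPred_testBit hv (.const 0)).not.and ?_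
  refine primrecPred_forall_lt hn (primrecPred_forall_lt (hn.comp .fst) ?_)
  refine .and (primrecPred_imp (Primrec.nat_lt.comp (primrec_impCode hb .snd) (hn.comp h)) ?_)
    (primrecPred_imp (Primrec.nat_lt.comp (primrec_rhdCode hb .snd) (hn.comp h))
      (primrecPred_imp ?_ (primrecPred_testBit (hv.comp h) (primrec_rhdCode hb .snd))))
  · exact primrecPred_iff (primrecPred_testBit (hv.comp h) (primrec_impCode hb .snd))
      (primrecPred_imp (primrecPred_testBit (hv.comp h) hb) (primrecPred_testBit (hv.comp h) .snd))
  · refine primrecPred_forall_lt (primrec_two_pow (hn.comp h))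
      (primrecPred_forall_lt (primrec_two_pow (hn.comp (h.comp .fst))) ?_)
    exact primrecPred_imp (primrecPred_access (hn.comp (h.comp h')) (hT.comp (h.comp h'))
        (hv.comp (h.comp h')) hx .snd)
      (primrecPred_imp (primrecPred_testBit hx (hb.comp h'))
        (primrecPred_testBit .snd (Primrec.snd.comp h')))

end Primrec

/-- Every quantifier, including the one over models, has a primitive recursive bound. -/
theorem primrecPred_refutable : PrimrecPred Refutable := by
  have hs : Primrec fun q : ℕ × ℕ ↦ q.1 + 1 := Primrec.succ.comp .fst
  have hs' : Primrec fun q : (ℕ × ℕ) × ℕ ↦ q.1.1 + 1 := hs.comp .fst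
  have hT : Primrec fun q : (ℕ × ℕ) × ℕ ↦ q.1.2 := Primrec.snd.comp .fst
  refine primrecPred_exists_lt (primrec_two_pow (primrec_two_pow .succ)) (.and ?_ ?_)
  · refine primrecPred_forall_lt (primrec_two_pow hs) ?_
    exact primrecPred_imp (primrecPred_testBit hT .snd) (primrecPred_coherent hs' hT .snd)
  · refine primrecPred_exists_lt (primrec_two_pow hs) ?_
    exact (primrecPred_testBit hT .snd).and
      (primrecPred_testBit .snd (Primrec.fst.comp .fst)).not

end RecFunLogic

/-- The modal logic `ℜ_d` is decidable: its set of theorems is a computable set of formulas. -/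
theorem mainTheorem7 :
    ComputablePred (fun φ : RecFunLogic.Formula => RecFunLogic.Provable φ) :=
  -- `encode` on formulas unfolds to `toNat`.
  ((RecFunLogic.primrecPred_refutable.comp Primrec.encode).not.of_eq fun φ ↦
    (RecFunLogic.provable_iff_not_refutable φ).symm).computablePred
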